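/- Let $K\subset\mathbb{R}^n$ be a convex body (compact and convex) containing the origin in its interior, and let $L$ be its Minkowski functional, so that $v/L(v)\in\partial K$ for $v\neq 0$. Suppose that $L$ is a Finsler–Minkowski functional, i.e. near each nonzero vector $L$ is of class $C^4$ and the Hessian matrix of $\tfrac12L^2$ is positive definite. For $p\in\operatorname{int}K$ let $F(v_p)=L_p(v)$ be the Funk metric, i.e. $L_p$ is the Minkowski functional of the translated body $K_p=K-p$, equivalently $L\bigl(p+v/L_p(v)\bigr)=1$ for $v\ne0$. Let $\partial K_p=\{y: L_p(y)=1\}$ and let $$\mu_p=\sqrt{\det g_{ij}}\;\sum_{i=1}^n(-1)^{i-1}y^i\,dy^1\wedge\dots\wedge dy^{i-1}\wedge dy^{i+1}\wedge\dots\wedge dy^n,\qquad g_{ij}=\frac12\frac{\partial^2F^2}{\partial y^i\partial y^j},$$ be the induced volume form on $\partial K_p$ (oriented by its outward normal). Let $r(p)=\operatorname{Area}(\partial K_p)=\int_{\partial K_p}1\,\mu_p$ for $p\in\operatorname{int}K$. Then the area function $r$ has continuous partial derivatives of every order on $\operatorname{int}K$ (that is, $r$ is $C^\infty$ there), and for every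 $p\in\operatorname{int}K$ and all integers $i_1,\dots,i_n\ge 0$ with $m=i_1+\dots+i_n$, the integral below converges and $$\frac{\partial^m r}{\partial u^{1\,i_1}\cdots\partial u^{n\,i_n}}(p)=c_m\int_{\partial K_p}\left(\frac{\partial F}{\partial y^1}\right)^{i_1}\cdots\left(\frac{\partial F}{\partial y^n}\right)^{i_n}\mu_p,$$ where $\partial^m/\partial u^{1\,i_1}\cdots\partial u^{n\,i_n}$ means differentiating $i_j$ times with respect to the $j$-th coordinate for each $j$, and $$c_0=1,\qquad c_m=\frac{(n-1)(n+1)\cdots\bigl((n-1)+2(m-1)\bigr)}{2^m}\quad(m\ge1).$$ -/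

import Mathlib

open MeasureTheory
open scoped ContDiff

noncomputable section

namespace Funk

/-- The partial derivative `∂f/∂yʲ` with respect to the `j`-th canonical coordinate of `ℝⁿ`. -/
def partialDeriv {n : ℕ} (j : Fin n) (f : EuclideanSpace ℝ (Fin n) → ℝ) :
    EuclideanSpace ℝ (Fin n) → ℝ :=
  fun y => lineDeriv ℝ f y (EuclideanSpace.single j 1)

/-- The mixed partial derivative `∂ᵐf / (∂u¹)^{i₁} … (∂uⁿ)^{iₙ}` of order `m = i₁ + … + iₙ`,
for a multi-index `i`. -/
def mixedPartial {n : ℕ} (i : Fin n → ℕ) (f : EuclideanSpace ℝ (Fin n) → ℝ) :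
    EuclideanSpace ℝ (Fin n) → ℝ :=
  (List.finRange n).foldr (fun j h => (partialDeriv j)^[i j] h) f

/-- The matrix `g_{ij} = ∂²E/∂yʲ∂yⁱ` at `y`, where `E = L²/2` is the energy function. -/
def metricMatrix {n : ℕ} (L : EuclideanSpace ℝ (Fin n) → ℝ) (y : EuclideanSpace ℝ (Fin n)) :
    Matrix (Fin n) (Fin n) ℝ :=
  Matrix.of fun i j => partialDeriv j (partialDeriv i fun z => L z ^ 2 / 2) y

/-- Regularity of a Minkowski functional: around each nonzero vector it is of class at least `C⁴`
and the Hessian matrix of its energy function is positive definite. -/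
def IsFinslerMinkowski {n : ℕ} (L : EuclideanSpace ℝ (Fin n) → ℝ) : Prop :=
  ∀ v, v ≠ 0 → ContDiffAt ℝ 4 L v ∧ (metricMatrix L v).PosDef

/-- The body `K_p = K - p`, seen from the base point `p`. -/
def bodyAt {n : ℕ} (K : Set (EuclideanSpace ℝ (Fin n))) (p : EuclideanSpace ℝ (Fin n)) :
    Set (EuclideanSpace ℝ (Fin n)) :=
  {v | p + v ∈ K}

/-- The Funk metric `v_p ↦ F(v_p) = L_p(v)` of `K`: the Minkowski functional of `K` with `p` as the
origin. For `p` in the interior of `K` and `v ≠ 0`, it is the positive number with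
`p + v / L_p(v) ∈ ∂K`. -/
def metric {n : ℕ} (K : Set (EuclideanSpace ℝ (Fin n))) (p : EuclideanSpace ℝ (Fin n)) :
    EuclideanSpace ℝ (Fin n) → ℝ :=
  gauge (bodyAt K p)

/-- The indicatrix hypersurface `∂K_p`, the set of unit vectors of the Funk metric at `p`. -/
def indicatrix {n : ℕ} (K : Set (EuclideanSpace ℝ (Fin n))) (p : EuclideanSpace ℝ (Fin n)) :
    Set (EuclideanSpace ℝ (Fin n)) :=
  {y | metric K p y = 1}

/-- The Euclidean outward unit normal vector of the indicatrix `∂K_p` at `y`. -/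
def unitNormal {n : ℕ} (K : Set (EuclideanSpace ℝ (Fin n))) (p y : EuclideanSpace ℝ (Fin n)) :
    EuclideanSpace ℝ (Fin n) :=
  ‖gradient (metric K p) y‖⁻¹ • gradient (metric K p) y

/-- The measure on `∂K_p` given by the induced volume form
`μ_p = ι_C (√(det g) dy¹ ∧ … ∧ dyⁿ) = √(det g) ∑ (-1)^{i-1} yⁱ dy¹ ∧ … ∧ dyⁿ` (`dyⁱ` omitted in the
`i`-th term), where `C = ∑ yⁱ ∂/∂yⁱ` and `∂K_p` is oriented by its outward normal `N`. The
contraction of the Euclidean volume form with a vector field `C` restricts to a hypersurface as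
`⟨C, N⟩` times the Euclidean surface area element, which is the `(n-1)`-dimensional Hausdorff
measure (normalized to agree with Lebesgue measure on `(n-1)`-dimensional Euclidean spaces). -/
def indicatrixMeasure {n : ℕ} (K : Set (EuclideanSpace ℝ (Fin n)))
    (p : EuclideanSpace ℝ (Fin n)) : Measure (EuclideanSpace ℝ (Fin n)) :=
  ((μHE[n - 1] : Measure (EuclideanSpace ℝ (Fin n))).restrict (indicatrix K p)).withDensity
    fun y => ENNReal.ofReal
      (Real.sqrt (metricMatrix (metric K p) y).det * inner ℝ y (unitNormal K p y))

/-- The area function `r(p) = Area(∂K_p) = ∫_{∂K_p} 1 μ_p`. -/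
def area {n : ℕ} (K : Set (EuclideanSpace ℝ (Fin n))) (p : EuclideanSpace ℝ (Fin n)) : ℝ :=
  ∫ _y, (1 : ℝ) ∂(indicatrixMeasure K p)

/-- The constant `c_m = (n-1)(n+1)⋯((n-1)+2(m-1)) / 2ᵐ`, with `c_0 = 1`. -/
def coeff (n m : ℕ) : ℝ :=
  (∏ k ∈ Finset.range m, (((n : ℝ) - 1) + 2 * (k : ℝ))) / 2 ^ m

end Funk

end

noncomputable section

namespace Funk

open Filter Topology

section Implicit

variable {E : Type*} [NormedAddCommGroup E] [NormedSpace ℝ E]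

/-- The shear `u ↦ u - ℓ u • p`, invertible when `ℓ p ≠ 1`. -/
def shearEquiv (ℓ : E →L[ℝ] ℝ) (p : E) (h : 1 - ℓ p ≠ 0) : E ≃L[ℝ] E :=
  ContinuousLinearEquiv.equivOfInverse
    (ContinuousLinearMap.id ℝ E - ℓ.smulRight p)
    (ContinuousLinearMap.id ℝ E + ((1 - ℓ p)⁻¹ • ℓ).smulRight p)
    (fun u => by
      simp only [sub_apply, add_apply,
        ContinuousLinearMap.id_apply, ContinuousLinearMap.smulRight_apply,
        smul_apply, map_sub, map_smul, smul_eq_mul]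
      match_scalars <;> field_simp
      ring)
    (fun u => by
      simp only [sub_apply, add_apply,
        ContinuousLinearMap.id_apply, ContinuousLinearMap.smulRight_apply,
        smul_apply, map_add, map_smul, smul_eq_mul]
      match_scalars <;> field_simp
      ring)

/-- Implicit differentiation of `L (F v • p + v) = F v`: the derivative of `v ↦ F v • p + v`. -/
theorem hasFDerivAt_shift_of_implicit {L F : E → ℝ} {p v : E} {ℓ : E →L[ℝ] ℝ}
    (hF : ContinuousAt F v) (hLF : ∀ᶠ u in 𝓝 v, L (F u • p + u) = F u)
    (hL : HasFDerivAt L ℓ (F v • p + v)) (h : 1 - ℓ p ≠ 0) :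
    HasFDerivAt (fun u => F u • p + u)
      (ContinuousLinearMap.id ℝ E + ((1 - ℓ p)⁻¹ • ℓ).smulRight p) v := by
  have h1 : HasFDerivAt (fun w => w - L w • p) (shearEquiv ℓ p h : E →L[ℝ] E)
      ((fun u => F u • p + u) v) :=
    (hasFDerivAt_id _).sub (hL.smul_const p)
  refine HasFDerivAt.of_local_left_inverse (f' := shearEquiv ℓ p h) ?_ h1 ?_
  · exact (hF.smul continuousAt_const).add continuousAt_id
  · filter_upwards [hLF] with u hu
    rw [hu]; abel

/-- Implicit differentiation of `L (F v • p + v) = F v`. -/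
theorem hasFDerivAt_of_implicit {L F : E → ℝ} {p v : E} {ℓ : E →L[ℝ] ℝ}
    (hF : ContinuousAt F v) (hLF : ∀ᶠ u in 𝓝 v, L (F u • p + u) = F u)
    (hL : HasFDerivAt L ℓ (F v • p + v)) (h : 1 - ℓ p ≠ 0) :
    HasFDerivAt F ((1 - ℓ p)⁻¹ • ℓ) v := by
  have h1 := HasFDerivAt.comp (f := fun u => F u • p + u) v hL
    (hasFDerivAt_shift_of_implicit hF hLF hL h)
  refine (h1.congr_of_eventuallyEq (hLF.mono fun u hu => hu.symm)).congr_fderiv ?_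
  ext u
  simp only [ContinuousLinearMap.comp_apply, add_apply,
    ContinuousLinearMap.id_apply, ContinuousLinearMap.smulRight_apply,
    smul_apply, map_add, map_smul, smul_eq_mul]
  field_simp
  ring

end Implicit

section Homogeneous

variable {E : Type*} [NormedAddCommGroup E] [NormedSpace ℝ E] {L : E → ℝ}

theorem fderiv_apply_self_of_homogeneous (hL : ∀ t : ℝ, 0 < t → ∀ v, L (t • v) = t * L v)
    {x : E} (hx : DifferentiableAt ℝ L x) : fderiv ℝ L x x = L x := by
  have h1 : HasDerivAt (fun t : ℝ => t • x) x 1 := by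
    simpa using (hasDerivAt_id (1 : ℝ)).smul_const x
  have h2 : HasDerivAt (fun t : ℝ => L (t • x)) (fderiv ℝ L x x) 1 :=
    HasFDerivAt.comp_hasDerivAt (l := L) 1 (by simpa using hx.hasFDerivAt) h1
  have h3 : HasDerivAt (fun t : ℝ => t * L x) (L x) 1 := by
    simpa using (hasDerivAt_id (1 : ℝ)).mul_const (L x)
  refine h2.unique (h3.congr_of_eventuallyEq ?_)
  filter_upwards [lt_mem_nhds one_pos] with t ht using hL t ht x

theorem fderiv_smul_of_homogeneous (hL : ∀ t : ℝ, 0 < t → ∀ v, L (t • v) = t * L v)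
    {t : ℝ} (ht : 0 < t) (x : E) : fderiv ℝ L (t • x) = fderiv ℝ L x := by
  have h1 : fderiv ℝ (fun v => L (t • v)) x = t • fderiv ℝ L (t • x) := fderiv_comp_smul ..
  have h2 : (fun v => L (t • v)) = t • L := funext fun v => hL t ht v
  rw [h2, fderiv_const_smul_field] at h1
  exact (smul_right_injective _ ht.ne' h1).symm

theorem fderiv_fderiv_apply_self_of_homogeneous
    (hL : ∀ t : ℝ, 0 < t → ∀ v, L (t • v) = t * L v)
    {x : E} (hx : DifferentiableAt ℝ (fderiv ℝ L) x) : fderiv ℝ (fderiv ℝ L) x x = 0 := by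
  have h1 : HasDerivAt (fun t : ℝ => t • x) x 1 := by
    simpa using (hasDerivAt_id (1 : ℝ)).smul_const x
  have h2 : HasDerivAt (fun t : ℝ => fderiv ℝ L (t • x)) (fderiv ℝ (fderiv ℝ L) x x) 1 :=
    HasFDerivAt.comp_hasDerivAt (l := fderiv ℝ L) 1 (by simpa using hx.hasFDerivAt) h1
  refine h2.unique ((hasDerivAt_const (1 : ℝ) (fderiv ℝ L x)).congr_of_eventuallyEq ?_)
  filter_upwards [lt_mem_nhds one_pos] with t ht using fderiv_smul_of_homogeneous hL ht x

theorem fderiv_apply_le_of_sublinear (hL : ∀ t : ℝ, 0 < t → ∀ v, L (t • v) = t * L v)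
    (hadd : ∀ v w, L (v + w) ≤ L v + L w)
    {x : E} (hx : DifferentiableAt ℝ L x) (p : E) : fderiv ℝ L x p ≤ L p := by
  have h1 : HasDerivAt (fun t : ℝ => x + t • p) p 0 := by
    simpa using ((hasDerivAt_id (0 : ℝ)).smul_const p).const_add x
  have h2 : HasDerivAt (fun t : ℝ => L (x + t • p)) (fderiv ℝ L x p) 0 :=
    HasFDerivAt.comp_hasDerivAt (l := L) 0 (by simpa using hx.hasFDerivAt) h1
  refine le_of_tendsto h2.tendsto_slope_zero_right ?_
  filter_upwards [self_mem_nhdsWithin] with t ht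
  have ht : (0 : ℝ) < t := ht
  have := hadd x (t • p)
  rw [hL t ht] at this
  simp only [zero_add, zero_smul, add_zero, smul_eq_mul]
  rw [inv_mul_le_iff₀ ht]
  linarith

end Homogeneous

section Gauge

variable {n : ℕ} {K : Set (EuclideanSpace ℝ (Fin n))} {p : EuclideanSpace ℝ (Fin n)}

theorem bodyAt_eq_image : bodyAt K p = (Homeomorph.addLeft p) ⁻¹' K := rfl

theorem convex_bodyAt (hK : Convex ℝ K) : Convex ℝ (bodyAt K p) := by
  have : bodyAt K p = (fun z => p + z) ⁻¹' K := rfl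
  rw [this]
  exact hK.translate_preimage_right p

theorem bodyAt_mem_nhds_zero (hp : p ∈ interior K) : bodyAt K p ∈ 𝓝 0 := by
  have h : Tendsto (fun v => p + v) (𝓝 0) (𝓝 p) := by
    simpa using (continuous_const_add p).tendsto 0
  exact h (mem_interior_iff_mem_nhds.1 hp)

theorem isBounded_bodyAt (hb : Bornology.IsBounded K) : Bornology.IsBounded (bodyAt K p) := by
  have : bodyAt K p = (IsometryEquiv.addLeft p) ⁻¹' K := rfl
  rw [this, ← IsometryEquiv.image_symm]
  exact (IsometryEquiv.addLeft p).symm.isometry.lipschitz.isBounded_image hb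

theorem metric_pos (hb : Bornology.IsBounded K) (hp : p ∈ interior K)
    {v : EuclideanSpace ℝ (Fin n)} (hv : v ≠ 0) : 0 < metric K p v :=
  (gauge_pos (absorbent_nhds_zero (bodyAt_mem_nhds_zero hp))
    ((NormedSpace.isVonNBounded_iff ℝ).2 (isBounded_bodyAt hb))).2 hv

theorem metric_zero_left : metric K 0 = gauge K := by
  simp [metric, bodyAt]

theorem metric_smul {t : ℝ} (ht : 0 < t) (v : EuclideanSpace ℝ (Fin n)) :
    metric K p (t • v) = t * metric K p v :=
  gauge_smul_of_nonneg ht.le v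

theorem continuous_metric (hK : Convex ℝ K) (hp : p ∈ interior K) : Continuous (metric K p) :=
  continuous_gauge (convex_bodyAt hK) (bodyAt_mem_nhds_zero hp)

theorem metric_eq_one_iff (hK : Convex ℝ K) (hp : p ∈ interior K)
    (h0 : (0 : EuclideanSpace ℝ (Fin n)) ∈ interior K) {y : EuclideanSpace ℝ (Fin n)} :
    metric K p y = 1 ↔ gauge K (p + y) = 1 := by
  rw [metric, gauge_eq_one_iff_mem_frontier (convex_bodyAt hK) (bodyAt_mem_nhds_zero hp),
    gauge_eq_one_iff_mem_frontier hK (mem_interior_iff_mem_nhds.1 h0), bodyAt_eq_image,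
    ← Homeomorph.preimage_frontier]
  rfl

theorem indicatrix_eq_preimage (hK : Convex ℝ K) (hp : p ∈ interior K)
    (h0 : (0 : EuclideanSpace ℝ (Fin n)) ∈ interior K) :
    indicatrix K p = (fun y => p + y) ⁻¹' indicatrix K 0 := by
  ext y
  simp [indicatrix, metric_eq_one_iff hK hp h0, metric_zero_left]

/-- The defining relation of the Funk metric. -/
theorem gauge_metric_smul_add (hK : Convex ℝ K) (hb : Bornology.IsBounded K)
    (hp : p ∈ interior K) (h0 : (0 : EuclideanSpace ℝ (Fin n)) ∈ interior K)
    {v : EuclideanSpace ℝ (Fin n)} (hv : v ≠ 0) :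
    gauge K (metric K p v • p + v) = metric K p v := by
  have ht := metric_pos hb hp hv
  have h1 : metric K p ((metric K p v)⁻¹ • v) = 1 := by
    rw [metric_smul (inv_pos.2 ht), inv_mul_cancel₀ ht.ne']
  rw [metric_eq_one_iff hK hp h0] at h1
  have h2 : metric K p v • p + v = metric K p v • (p + (metric K p v)⁻¹ • v) := by
    rw [smul_add, smul_inv_smul₀ ht.ne']
  rw [h2, gauge_smul_of_nonneg ht.le, h1, smul_eq_mul, mul_one]

theorem gauge_add_le_of_mem_interior (hK : Convex ℝ K)
    (h0 : (0 : EuclideanSpace ℝ (Fin n)) ∈ interior K) (v w : EuclideanSpace ℝ (Fin n)) :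
    gauge K (v + w) ≤ gauge K v + gauge K w :=
  gauge_add_le hK (absorbent_nhds_zero (mem_interior_iff_mem_nhds.1 h0)) v w

theorem gauge_pos_smul {t : ℝ} (ht : 0 < t) (v : EuclideanSpace ℝ (Fin n)) :
    gauge K (t • v) = t * gauge K v :=
  gauge_smul_of_nonneg ht.le v

theorem fderiv_gauge_apply_lt_one (hK : Convex ℝ K) (hp : p ∈ interior K)
    (h0 : (0 : EuclideanSpace ℝ (Fin n)) ∈ interior K) {x : EuclideanSpace ℝ (Fin n)}
    (hx : DifferentiableAt ℝ (gauge K) x) : fderiv ℝ (gauge K) x p < 1 :=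
  (fderiv_apply_le_of_sublinear (fun _ ht v => gauge_pos_smul ht v)
    (gauge_add_le_of_mem_interior hK h0) hx p).trans_lt
    ((gauge_lt_one_iff_mem_interior hK (mem_interior_iff_mem_nhds.1 h0)).2 hp)

end Gauge

section Hessian

variable {n : ℕ}

theorem sum_smul_single (u : EuclideanSpace ℝ (Fin n)) :
    ∑ k, u k • EuclideanSpace.single k (1 : ℝ) = u := by
  simpa using (EuclideanSpace.basisFun (Fin n) ℝ).sum_repr u

theorem partialDeriv_eq_fderiv {f : EuclideanSpace ℝ (Fin n) → ℝ} {y : EuclideanSpace ℝ (Fin n)}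
    (hf : DifferentiableAt ℝ f y) (j : Fin n) :
    partialDeriv j f y = fderiv ℝ f y (EuclideanSpace.single j 1) :=
  hf.lineDeriv_eq_fderiv

theorem partialDeriv_congr {f g : EuclideanSpace ℝ (Fin n) → ℝ} {y : EuclideanSpace ℝ (Fin n)}
    (h : f =ᶠ[𝓝 y] g) (j : Fin n) : partialDeriv j f y = partialDeriv j g y :=
  h.lineDeriv_eq

theorem metricMatrix_eq {L : EuclideanSpace ℝ (Fin n) → ℝ} {y : EuclideanSpace ℝ (Fin n)}
    (hL : ∀ᶠ z in 𝓝 y, DifferentiableAt ℝ L z) (hL' : DifferentiableAt ℝ (fderiv ℝ L) y) :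
    metricMatrix L y = Matrix.of fun i j =>
      L y * fderiv ℝ (fderiv ℝ L) y (EuclideanSpace.single j 1) (EuclideanSpace.single i 1) +
        fderiv ℝ L y (EuclideanSpace.single j 1) * fderiv ℝ L y (EuclideanSpace.single i 1) := by
  ext i j
  simp only [metricMatrix, Matrix.of_apply]
  have h1 : partialDeriv i (fun z => L z ^ 2 / 2) =ᶠ[𝓝 y]
      fun z => L z * fderiv ℝ L z (EuclideanSpace.single i 1) := by
    filter_upwards [hL] with z hz
    have h2 : HasFDerivAt (fun z => L z ^ 2 / 2) (L z • fderiv ℝ L z) z := by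
      refine ((hz.hasFDerivAt.pow 2).mul_const (2⁻¹ : ℝ)).congr_fderiv ?_
      ext u
      simp
      ring
    rw [partialDeriv_eq_fderiv h2.differentiableAt, h2.fderiv]
    rfl
  have h3 : HasFDerivAt (fun z => L z * fderiv ℝ L z (EuclideanSpace.single i 1)) _ y :=
    hL.self_of_nhds.hasFDerivAt.mul (hL'.hasFDerivAt.clm_apply (hasFDerivAt_const (EuclideanSpace.single i (1 : ℝ)) y))
  rw [partialDeriv_congr h1, partialDeriv_eq_fderiv h3.differentiableAt, h3.fderiv]
  simp
  ring

theorem det_single_add_smul (ℓ : EuclideanSpace ℝ (Fin n) →L[ℝ] ℝ) (q : EuclideanSpace ℝ (Fin n)) :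
    (Matrix.of fun k j => (EuclideanSpace.single j (1 : ℝ) +
      ℓ (EuclideanSpace.single j 1) • q : EuclideanSpace ℝ (Fin n)) k).det = 1 + ℓ q := by
  have h : (Matrix.of fun k j => (EuclideanSpace.single j (1 : ℝ) +
      ℓ (EuclideanSpace.single j 1) • q : EuclideanSpace ℝ (Fin n)) k) =
      1 + Matrix.replicateCol Unit (q : Fin n → ℝ) *
        Matrix.replicateRow Unit (fun j => ℓ (EuclideanSpace.single j 1)) := by
    ext k j
    simp [Matrix.mul_apply, Matrix.one_apply, mul_comm, PiLp.single_apply]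
  rw [h, Matrix.det_one_add_replicateCol_mul_replicateRow]
  conv_rhs => rw [← sum_smul_single q, map_sum]
  simp [dotProduct, mul_comm]

theorem bilin_eq_mul (B : EuclideanSpace ℝ (Fin n) →L[ℝ] EuclideanSpace ℝ (Fin n) →L[ℝ] ℝ)
    (u v : Fin n → EuclideanSpace ℝ (Fin n)) :
    (Matrix.of fun i j => B (u j) (v i)) =
      (Matrix.of fun l i => v i l).transpose *
        (Matrix.of fun i j => B (EuclideanSpace.single j 1) (EuclideanSpace.single i 1)) *
        Matrix.of fun k j => u j k := by
  ext i j
  simp only [Matrix.of_apply, Matrix.mul_apply, Matrix.transpose_apply]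
  conv_lhs => rw [← sum_smul_single (u j), ← sum_smul_single (v i)]
  simp only [map_sum, map_smul, sum_apply, smul_apply, smul_eq_mul,
    Finset.sum_mul, Finset.mul_sum]
  rw [Finset.sum_comm]
  refine Finset.sum_congr rfl fun k _ => Finset.sum_congr rfl fun l _ => by ring

/-- The change of the determinant of a metric of the form `H + ℓ ⊗ ℓ` when the covector `ℓ` is
rescaled by `(1 - ℓ p)⁻¹` and `H` is pulled back along `u ↦ u + (1 - ℓ p)⁻¹ ℓ u • p`. -/
theorem det_hessian_shift
    (H : EuclideanSpace ℝ (Fin n) →L[ℝ] EuclideanSpace ℝ (Fin n) →L[ℝ] ℝ)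
    (ℓ : EuclideanSpace ℝ (Fin n) →L[ℝ] ℝ) {x p : EuclideanSpace ℝ (Fin n)} {s : ℝ}
    (hs : 1 - ℓ p = s) (hs0 : s ≠ 0) (hx : ℓ x = 1) (hH : H x = 0) :
    (Matrix.of fun i j : Fin n =>
      s⁻¹ * H (EuclideanSpace.single j 1 + (s⁻¹ * ℓ (EuclideanSpace.single j 1)) • p)
        (EuclideanSpace.single i 1 + (s⁻¹ * ℓ (EuclideanSpace.single i 1)) • p) +
      (s⁻¹ * ℓ (EuclideanSpace.single j 1)) * (s⁻¹ * ℓ (EuclideanSpace.single i 1))).det =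
    s⁻¹ ^ (n + 1) * (Matrix.of fun i j : Fin n =>
      H (EuclideanSpace.single j 1) (EuclideanSpace.single i 1) +
        ℓ (EuclideanSpace.single j 1) * ℓ (EuclideanSpace.single i 1)).det := by
  have hp : ℓ p = 1 - s := by linarith
  set B := H + ℓ.smulRight ℓ with hB
  obtain ⟨q, hq⟩ : ∃ q, q = s⁻¹ • p + ((s - 1) * s⁻¹) • x := ⟨_, rfl⟩
  obtain ⟨r, hr⟩ : ∃ r, r = s⁻¹ • p := ⟨_, rfl⟩
  have hℓr : 1 + ℓ r = s⁻¹ := by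
    simp only [hr, map_smul, hp, smul_eq_mul]; field_simp; ring
  have hℓq : 1 + ℓ q = 1 := by
    simp only [hq, map_add, map_smul, hp, hx, smul_eq_mul]; field_simp; ring
  have h1 : (Matrix.of fun i j : Fin n =>
      s⁻¹ * H (EuclideanSpace.single j 1 + (s⁻¹ * ℓ (EuclideanSpace.single j 1)) • p)
        (EuclideanSpace.single i 1 + (s⁻¹ * ℓ (EuclideanSpace.single i 1)) • p) +
      (s⁻¹ * ℓ (EuclideanSpace.single j 1)) * (s⁻¹ * ℓ (EuclideanSpace.single i 1))) =
      s⁻¹ • Matrix.of fun i j : Fin n =>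
        B (EuclideanSpace.single j 1 + ℓ (EuclideanSpace.single j 1) • q)
          (EuclideanSpace.single i 1 + ℓ (EuclideanSpace.single i 1) • r) := by
    ext i j
    simp only [Matrix.of_apply, Matrix.smul_apply, smul_eq_mul, hB, hq, hr, add_apply, map_add,
      map_smul, smul_apply, ContinuousLinearMap.smulRight_apply, hH, hp, hx,
      zero_apply]
    field_simp
    ring
  have h2 : (Matrix.of fun i j : Fin n =>
      H (EuclideanSpace.single j 1) (EuclideanSpace.single i 1) +
        ℓ (EuclideanSpace.single j 1) * ℓ (EuclideanSpace.single i 1)) =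
      Matrix.of fun i j : Fin n => B (EuclideanSpace.single j 1) (EuclideanSpace.single i 1) := by
    ext i j
    simp [hB]
  rw [h1, h2, Matrix.det_smul, bilin_eq_mul, Matrix.det_mul, Matrix.det_mul, Matrix.det_transpose,
    det_single_add_smul, det_single_add_smul, hℓr, hℓq, Fintype.card_fin]
  ring

end Hessian

section Metric

variable {n : ℕ} {K : Set (EuclideanSpace ℝ (Fin n))} {p : EuclideanSpace ℝ (Fin n)}

theorem IsFinslerMinkowski.contDiffAt_fderiv {L : EuclideanSpace ℝ (Fin n) → ℝ}
    (hL : IsFinslerMinkowski L) {v : EuclideanSpace ℝ (Fin n)} (hv : v ≠ 0) :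
    ContDiffAt ℝ 1 (fderiv ℝ L) v :=
  (hL v hv).1.fderiv_right (by norm_num)

theorem IsFinslerMinkowski.differentiableAt {L : EuclideanSpace ℝ (Fin n) → ℝ}
    (hL : IsFinslerMinkowski L) {v : EuclideanSpace ℝ (Fin n)} (hv : v ≠ 0) :
    DifferentiableAt ℝ L v :=
  (hL v hv).1.differentiableAt (by norm_num)

theorem metric_smul_add_ne_zero (hK : Convex ℝ K) (hb : Bornology.IsBounded K)
    (hp : p ∈ interior K) (h0 : (0 : EuclideanSpace ℝ (Fin n)) ∈ interior K)
    {v : EuclideanSpace ℝ (Fin n)} (hv : v ≠ 0) : metric K p v • p + v ≠ 0 := by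
  intro h
  have h1 := gauge_metric_smul_add hK hb hp h0 hv
  rw [h, gauge_zero] at h1
  exact (metric_pos hb hp hv).ne h1

theorem one_sub_fderiv_gauge_pos (hK : Convex ℝ K) (hp : p ∈ interior K)
    (h0 : (0 : EuclideanSpace ℝ (Fin n)) ∈ interior K) (hL : IsFinslerMinkowski (gauge K))
    {x : EuclideanSpace ℝ (Fin n)} (hx : x ≠ 0) : 0 < 1 - fderiv ℝ (gauge K) x p :=
  sub_pos.2 (fderiv_gauge_apply_lt_one hK hp h0 (hL.differentiableAt hx))

theorem hasFDerivAt_metric_smul_add (hK : Convex ℝ K) (hb : Bornology.IsBounded K)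
    (hp : p ∈ interior K) (h0 : (0 : EuclideanSpace ℝ (Fin n)) ∈ interior K)
    (hL : IsFinslerMinkowski (gauge K)) {v : EuclideanSpace ℝ (Fin n)} (hv : v ≠ 0) :
    HasFDerivAt (fun u => metric K p u • p + u)
      (ContinuousLinearMap.id ℝ (EuclideanSpace ℝ (Fin n)) +
        ((1 - fderiv ℝ (gauge K) (metric K p v • p + v) p)⁻¹ •
          fderiv ℝ (gauge K) (metric K p v • p + v)).smulRight p) v := by
  have hw := metric_smul_add_ne_zero hK hb hp h0 hv
  refine hasFDerivAt_shift_of_implicit (continuous_metric hK hp).continuousAt ?_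
    (hL.differentiableAt hw).hasFDerivAt (one_sub_fderiv_gauge_pos hK hp h0 hL hw).ne'
  filter_upwards [isOpen_ne.mem_nhds hv] with u hu using gauge_metric_smul_add hK hb hp h0 hu

theorem hasFDerivAt_metric (hK : Convex ℝ K) (hb : Bornology.IsBounded K)
    (hp : p ∈ interior K) (h0 : (0 : EuclideanSpace ℝ (Fin n)) ∈ interior K)
    (hL : IsFinslerMinkowski (gauge K)) {v : EuclideanSpace ℝ (Fin n)} (hv : v ≠ 0) :
    HasFDerivAt (metric K p) ((1 - fderiv ℝ (gauge K) (metric K p v • p + v) p)⁻¹ •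
      fderiv ℝ (gauge K) (metric K p v • p + v)) v := by
  have hw := metric_smul_add_ne_zero hK hb hp h0 hv
  refine hasFDerivAt_of_implicit (continuous_metric hK hp).continuousAt ?_
    (hL.differentiableAt hw).hasFDerivAt (one_sub_fderiv_gauge_pos hK hp h0 hL hw).ne'
  filter_upwards [isOpen_ne.mem_nhds hv] with u hu using gauge_metric_smul_add hK hb hp h0 hu

theorem hasFDerivAt_fderiv_metric (hK : Convex ℝ K) (hb : Bornology.IsBounded K)
    (hp : p ∈ interior K) (h0 : (0 : EuclideanSpace ℝ (Fin n)) ∈ interior K)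
    (hL : IsFinslerMinkowski (gauge K)) {v w : EuclideanSpace ℝ (Fin n)} (hv : v ≠ 0)
    (hwe : metric K p v • p + v = w) :
    DifferentiableAt ℝ (fderiv ℝ (metric K p)) v ∧
    ∀ s ℓ, fderiv ℝ (gauge K) w = ℓ → 1 - ℓ p = s → ∀ a b,
      fderiv ℝ (fderiv ℝ (metric K p)) v a b =
        s⁻¹ * fderiv ℝ (fderiv ℝ (gauge K)) w (a + (s⁻¹ * ℓ a) • p) (b + (s⁻¹ * ℓ b) • p) := by
  have hw := metric_smul_add_ne_zero hK hb hp h0 hv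
  have hs := (one_sub_fderiv_gauge_pos hK hp h0 hL hw).ne'
  have h1 : HasFDerivAt (fun u => fderiv ℝ (gauge K) (metric K p u • p + u)) _ v :=
    HasFDerivAt.comp (f := fun u => metric K p u • p + u) v
      ((hL.contDiffAt_fderiv hw).differentiableAt (by norm_num)).hasFDerivAt
      (hasFDerivAt_metric_smul_add hK hb hp h0 hL hv)
  have h2 := (h1.clm_apply (hasFDerivAt_const p v)).const_sub 1
  have h3 := HasDerivAt.comp_hasFDerivAt v (hasDerivAt_inv hs) h2
  have h4 := h3.smul h1
  have h5 := h4.congr_of_eventuallyEq (f₁ := fderiv ℝ (metric K p)) (by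
    filter_upwards [isOpen_ne.mem_nhds hv] with u hu using
      (hasFDerivAt_metric hK hb hp h0 hL hu).fderiv)
  refine ⟨h5.differentiableAt, ?_⟩
  rintro s ℓ hℓ hse a b
  rw [h5.fderiv]
  rw [hwe, hℓ, hse] at hs
  simp [hwe, hℓ, hse]
  field_simp
  ring

end Metric

section Density

variable {n : ℕ} {K : Set (EuclideanSpace ℝ (Fin n))} {p : EuclideanSpace ℝ (Fin n)}

/-- The density of `indicatrixMeasure K p` with respect to the Hausdorff measure. -/
def density (K : Set (EuclideanSpace ℝ (Fin n))) (p y : EuclideanSpace ℝ (Fin n)) : ℝ :=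
  Real.sqrt (metricMatrix (metric K p) y).det * inner ℝ y (unitNormal K p y)

theorem ne_zero_of_mem_indicatrix {y : EuclideanSpace ℝ (Fin n)} (hy : y ∈ indicatrix K p) :
    y ≠ 0 := by
  rintro rfl
  simp [indicatrix, metric] at hy

theorem mem_indicatrix_zero {x : EuclideanSpace ℝ (Fin n)} :
    x ∈ indicatrix K 0 ↔ gauge K x = 1 := by
  simp [indicatrix, metric_zero_left]

theorem add_mem_indicatrix_zero (hK : Convex ℝ K) (hp : p ∈ interior K)
    (h0 : (0 : EuclideanSpace ℝ (Fin n)) ∈ interior K) {y : EuclideanSpace ℝ (Fin n)}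
    (hy : y ∈ indicatrix K p) : p + y ∈ indicatrix K 0 := by
  rwa [indicatrix_eq_preimage hK hp h0] at hy

theorem fderiv_gauge_apply_self (hL : IsFinslerMinkowski (gauge K))
    {x : EuclideanSpace ℝ (Fin n)} (hx : x ∈ indicatrix K 0) :
    fderiv ℝ (gauge K) x x = 1 := by
  rw [fderiv_apply_self_of_homogeneous (fun _ ht v => gauge_pos_smul ht v)
    (hL.differentiableAt (ne_zero_of_mem_indicatrix hx)), mem_indicatrix_zero.1 hx]

theorem inner_gradient_eq_fderiv (f : EuclideanSpace ℝ (Fin n) → ℝ)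
    (y u : EuclideanSpace ℝ (Fin n)) : inner ℝ u (gradient f y) = fderiv ℝ f y u := by
  rw [real_inner_comm, gradient, InnerProductSpace.toDual_symm_apply]

theorem hasFDerivAt_metric_of_mem_indicatrix (hK : Convex ℝ K) (hb : Bornology.IsBounded K)
    (hp : p ∈ interior K) (h0 : (0 : EuclideanSpace ℝ (Fin n)) ∈ interior K)
    (hL : IsFinslerMinkowski (gauge K)) {y : EuclideanSpace ℝ (Fin n)}
    (hy : y ∈ indicatrix K p) :
    HasFDerivAt (metric K p)
      ((1 - fderiv ℝ (gauge K) (p + y) p)⁻¹ • fderiv ℝ (gauge K) (p + y)) y := by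
  have h := hasFDerivAt_metric hK hb hp h0 hL (ne_zero_of_mem_indicatrix hy)
  have hy' : metric K p y = 1 := hy
  rwa [hy', one_smul] at h

theorem unitNormal_eq (hK : Convex ℝ K) (hb : Bornology.IsBounded K)
    (hp : p ∈ interior K) (h0 : (0 : EuclideanSpace ℝ (Fin n)) ∈ interior K)
    (hL : IsFinslerMinkowski (gauge K)) {y : EuclideanSpace ℝ (Fin n)}
    (hy : y ∈ indicatrix K p) : unitNormal K p y = unitNormal K 0 (p + y) := by
  have hx := ne_zero_of_mem_indicatrix (add_mem_indicatrix_zero hK hp h0 hy)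
  have hs := one_sub_fderiv_gauge_pos hK hp h0 hL hx
  have h1 : gradient (metric K p) y =
      (1 - fderiv ℝ (gauge K) (p + y) p)⁻¹ • gradient (gauge K) (p + y) := by
    rw [gradient, (hasFDerivAt_metric_of_mem_indicatrix hK hb hp h0 hL hy).fderiv, map_smulₛₗ]
    rfl
  rw [unitNormal, unitNormal, metric_zero_left, h1, norm_smul, mul_inv, smul_smul, norm_inv,
    inv_inv, Real.norm_of_nonneg hs.le]
  congr 1
  field_simp

theorem inner_unitNormal_zero (hL : IsFinslerMinkowski (gauge K))
    {x : EuclideanSpace ℝ (Fin n)} (hx : x ∈ indicatrix K 0) :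
    inner ℝ x (unitNormal K 0 x) = ‖fderiv ℝ (gauge K) x‖⁻¹ := by
  rw [unitNormal, metric_zero_left, inner_smul_right, inner_gradient_eq_fderiv,
    fderiv_gauge_apply_self hL hx, mul_one, gradient, LinearIsometryEquiv.norm_map]

theorem inner_unitNormal (hK : Convex ℝ K) (hb : Bornology.IsBounded K)
    (hp : p ∈ interior K) (h0 : (0 : EuclideanSpace ℝ (Fin n)) ∈ interior K)
    (hL : IsFinslerMinkowski (gauge K)) {y : EuclideanSpace ℝ (Fin n)}
    (hy : y ∈ indicatrix K p) :
    inner ℝ y (unitNormal K p y) = (1 - fderiv ℝ (gauge K) (p + y) p) *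
      inner ℝ (p + y) (unitNormal K 0 (p + y)) := by
  have hx := add_mem_indicatrix_zero hK hp h0 hy
  rw [inner_unitNormal_zero hL hx, unitNormal_eq hK hb hp h0 hL hy, unitNormal, metric_zero_left,
    inner_smul_right, inner_gradient_eq_fderiv]
  have h1 := fderiv_gauge_apply_self hL hx
  rw [map_add] at h1
  rw [gradient, LinearIsometryEquiv.norm_map, mul_comm, eq_sub_of_add_eq' h1]

theorem eventually_differentiableAt_metric (hK : Convex ℝ K) (hb : Bornology.IsBounded K)
    (hp : p ∈ interior K) (h0 : (0 : EuclideanSpace ℝ (Fin n)) ∈ interior K)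
    (hL : IsFinslerMinkowski (gauge K)) {y : EuclideanSpace ℝ (Fin n)} (hy : y ≠ 0) :
    ∀ᶠ z in 𝓝 y, DifferentiableAt ℝ (metric K p) z := by
  filter_upwards [isOpen_ne.mem_nhds hy] with z hz using
    (hasFDerivAt_metric hK hb hp h0 hL hz).differentiableAt

theorem metricMatrix_gauge_eq (hL : IsFinslerMinkowski (gauge K))
    {x : EuclideanSpace ℝ (Fin n)} (hx : x ∈ indicatrix K 0) :
    metricMatrix (gauge K) x = Matrix.of fun i j =>
      fderiv ℝ (fderiv ℝ (gauge K)) x (EuclideanSpace.single j 1) (EuclideanSpace.single i 1) +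
        fderiv ℝ (gauge K) x (EuclideanSpace.single j 1) *
          fderiv ℝ (gauge K) x (EuclideanSpace.single i 1) := by
  have hx0 := ne_zero_of_mem_indicatrix hx
  rw [metricMatrix_eq, mem_indicatrix_zero.1 hx]
  · simp only [one_mul]
  · filter_upwards [isOpen_ne.mem_nhds hx0] with z hz using hL.differentiableAt hz
  · exact (hL.contDiffAt_fderiv hx0).differentiableAt (by norm_num)

theorem det_metricMatrix (hK : Convex ℝ K) (hb : Bornology.IsBounded K)
    (hp : p ∈ interior K) (h0 : (0 : EuclideanSpace ℝ (Fin n)) ∈ interior K)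
    (hL : IsFinslerMinkowski (gauge K)) {y : EuclideanSpace ℝ (Fin n)}
    (hy : y ∈ indicatrix K p) :
    (metricMatrix (metric K p) y).det = (1 - fderiv ℝ (gauge K) (p + y) p)⁻¹ ^ (n + 1) *
      (metricMatrix (metric K 0) (p + y)).det := by
  have hy0 := ne_zero_of_mem_indicatrix hy
  have hx := add_mem_indicatrix_zero hK hp h0 hy
  have hx0 := ne_zero_of_mem_indicatrix hx
  have hy1 : metric K p y = 1 := hy
  obtain ⟨h1, h2⟩ := hasFDerivAt_fderiv_metric hK hb hp h0 hL hy0 (w := p + y)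
    (by rw [hy1, one_smul])
  have h3 := (hasFDerivAt_metric_of_mem_indicatrix hK hb hp h0 hL hy).fderiv
  rw [metric_zero_left, metricMatrix_gauge_eq hL hx,
    ← det_hessian_shift (fderiv ℝ (fderiv ℝ (gauge K)) (p + y)) (fderiv ℝ (gauge K) (p + y))
      (x := p + y) (p := p) rfl (one_sub_fderiv_gauge_pos hK hp h0 hL hx0).ne'
      (fderiv_gauge_apply_self hL hx)
      (fderiv_fderiv_apply_self_of_homogeneous (fun _ ht v => gauge_pos_smul ht v)
        ((hL.contDiffAt_fderiv hx0).differentiableAt (by norm_num))),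
    metricMatrix_eq (eventually_differentiableAt_metric hK hb hp h0 hL hy0) h1]
  congr 1
  ext i j
  simp only [Matrix.of_apply, h2 _ _ rfl rfl, hy1, h3, one_mul, smul_apply, smul_eq_mul]

theorem density_eq (hK : Convex ℝ K) (hb : Bornology.IsBounded K)
    (hp : p ∈ interior K) (h0 : (0 : EuclideanSpace ℝ (Fin n)) ∈ interior K)
    (hL : IsFinslerMinkowski (gauge K)) {y : EuclideanSpace ℝ (Fin n)}
    (hy : y ∈ indicatrix K p) :
    density K p y = (1 - fderiv ℝ (gauge K) (p + y) p) ^ (-(((n : ℝ) - 1) / 2)) *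
      density K 0 (p + y) := by
  have hs := one_sub_fderiv_gauge_pos hK hp h0 hL
    (ne_zero_of_mem_indicatrix (add_mem_indicatrix_zero hK hp h0 hy))
  rw [density, density, det_metricMatrix hK hb hp h0 hL hy, inner_unitNormal hK hb hp h0 hL hy,
    Real.sqrt_mul (by positivity)]
  generalize 1 - fderiv ℝ (gauge K) (p + y) p = s at hs
  have h1 : Real.sqrt (s⁻¹ ^ (n + 1)) * s = s ^ (-(((n : ℝ) - 1) / 2)) := by
    rw [Real.sqrt_eq_rpow, ← Real.rpow_natCast, ← Real.rpow_neg_one, ← Real.rpow_mul hs.le,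
      ← Real.rpow_mul hs.le]
    conv_lhs => rw [← Real.rpow_one s, ← Real.rpow_mul hs.le, ← Real.rpow_add hs]
    congr 1
    push_cast
    ring
  rw [← h1]
  ring

theorem density_zero_nonneg (hL : IsFinslerMinkowski (gauge K))
    {x : EuclideanSpace ℝ (Fin n)} (hx : x ∈ indicatrix K 0) : 0 ≤ density K 0 x := by
  rw [density, inner_unitNormal_zero hL hx]
  positivity

theorem continuousOn_fderiv_gauge (hL : IsFinslerMinkowski (gauge K)) :
    ContinuousOn (fderiv ℝ (gauge K)) (indicatrix K 0) := fun _ hx =>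
  (hL.contDiffAt_fderiv (ne_zero_of_mem_indicatrix hx)).continuousAt.continuousWithinAt

theorem continuousOn_density_zero (hL : IsFinslerMinkowski (gauge K)) :
    ContinuousOn (density K 0) (indicatrix K 0) := by
  have h1 := continuousOn_fderiv_gauge hL
  have h2 : ContinuousOn (fderiv ℝ (fderiv ℝ (gauge K))) (indicatrix K 0) := fun x hx =>
    (((hL.contDiffAt_fderiv (ne_zero_of_mem_indicatrix hx)).fderiv_right
      (m := 0) (by norm_num)).continuousAt).continuousWithinAt
  have h3 : ContinuousOn (fun x => Real.sqrt (Matrix.of fun i j : Fin n =>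
      fderiv ℝ (fderiv ℝ (gauge K)) x (EuclideanSpace.single j 1) (EuclideanSpace.single i 1) +
        fderiv ℝ (gauge K) x (EuclideanSpace.single j 1) *
          fderiv ℝ (gauge K) x (EuclideanSpace.single i 1)).det * ‖fderiv ℝ (gauge K) x‖⁻¹)
      (indicatrix K 0) := by
    refine ContinuousOn.mul ?_ (h1.norm.inv₀ fun x hx h => ?_)
    · have h4 : Continuous fun M : Matrix (Fin n) (Fin n) ℝ => Real.sqrt M.det :=
        Real.continuous_sqrt.comp continuous_id.matrix_det
      refine h4.comp_continuousOn ?_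
      refine continuousOn_pi.2 fun i => continuousOn_pi.2 fun j => ?_
      exact (((h2.clm_apply continuousOn_const).clm_apply continuousOn_const).add
        ((h1.clm_apply continuousOn_const).mul (h1.clm_apply continuousOn_const)))
    · have h5 := fderiv_gauge_apply_self hL hx
      rw [norm_eq_zero.1 h] at h5
      simp at h5
  refine h3.congr fun x hx => ?_
  rw [density, inner_unitNormal_zero hL hx, metric_zero_left, metricMatrix_gauge_eq hL hx]

end Density

section Parametric

variable {n : ℕ} {X : Type*} [TopologicalSpace X] [MeasurableSpace X]
  [OpensMeasurableSpace X] [T2Space X]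

/-- The integral `∫_S φ x (1 - ℓ x p)^{-b} dμ`, as a function of `p`. -/
def powIntegral (μ : Measure X) (S : Set X) (ℓ : X → EuclideanSpace ℝ (Fin n) →L[ℝ] ℝ)
    (φ : X → ℝ) (b : ℝ) (p : EuclideanSpace ℝ (Fin n)) : ℝ :=
  ∫ x in S, φ x * (1 - ℓ x p) ^ (-b) ∂μ

variable {μ : Measure X} {S : Set X} {ℓ : X → EuclideanSpace ℝ (Fin n) →L[ℝ] ℝ}
  {U : Set (EuclideanSpace ℝ (Fin n))}

theorem hasFDerivAt_powIntegral (hS : IsCompact S) (hμ : μ S ≠ ⊤)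
    (hℓ : ContinuousOn ℓ S)
    (hU : IsOpen U) (hpos : ∀ p ∈ U, ∀ x ∈ S, 0 < 1 - ℓ x p) {φ : X → ℝ}
    (hφ : ContinuousOn φ S) (b : ℝ) {p : EuclideanSpace ℝ (Fin n)} (hp : p ∈ U) :
    HasFDerivAt (powIntegral μ S ℓ φ b)
      (∑ j, (b * powIntegral μ S ℓ (fun x => φ x * ℓ x (EuclideanSpace.single j 1)) (b + 1) p) •
        (EuclideanSpace.proj j : EuclideanSpace ℝ (Fin n) →L[ℝ] ℝ)) p := by
  have hSm : MeasurableSet S := hS.measurableSet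
  have hfin : IsFiniteMeasure (μ.restrict S) := ⟨by
    rw [Measure.restrict_apply_univ]; exact hμ.lt_top⟩
  obtain ⟨ε, hε, hball⟩ := Metric.nhds_basis_closedBall.mem_iff.1 (hU.mem_nhds hp)
  have hcont : ∀ c : ℝ, ∀ q ∈ U, ContinuousOn (fun x => (1 - ℓ x q) ^ c) S := fun c q hq =>
    (continuousOn_const.sub (hℓ.clm_apply continuousOn_const)).rpow_const
      fun x hx => Or.inl (hpos q hq x hx).ne'
  have hint : ∀ {F : Type} [NormedAddCommGroup F] [SecondCountableTopology F] {f : X → F},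
      ContinuousOn f S → Integrable f (μ.restrict S) := by
    intro F _ _ f hf
    obtain ⟨C, hC⟩ := hS.exists_bound_of_continuousOn hf
    refine Integrable.of_bound (hf.aestronglyMeasurable hSm) C ?_
    filter_upwards [ae_restrict_mem hSm] with x hx using hC x hx
  have hF' : ∀ q ∈ U, ContinuousOn (fun x => (b * φ x * (1 - ℓ x q) ^ (-(b + 1))) • ℓ x) S :=
    fun q hq => ((continuousOn_const.mul hφ).mul (hcont _ q hq)).smul hℓ
  have hjoint : ContinuousOn (fun z : EuclideanSpace ℝ (Fin n) × X =>
      (b * φ z.2 * (1 - ℓ z.2 z.1) ^ (-(b + 1))) • ℓ z.2) (Metric.closedBall p ε ×ˢ S) := by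
    have h2 : Set.MapsTo Prod.snd (Metric.closedBall p ε ×ˢ S) S := fun z hz => hz.2
    have hℓ2 : ContinuousOn (fun z : EuclideanSpace ℝ (Fin n) × X => ℓ z.2)
      (Metric.closedBall p ε ×ˢ S) := hℓ.comp continuousOn_snd h2
    refine ((continuousOn_const.mul (hφ.comp continuousOn_snd h2)).mul
      (ContinuousOn.rpow_const ?_ fun z hz => Or.inl (hpos _ (hball hz.1) _ hz.2).ne')).smul hℓ2
    exact continuousOn_const.sub (hℓ2.clm_apply continuousOn_fst)
  obtain ⟨C, hC⟩ := ((isCompact_closedBall p ε).prod hS).exists_bound_of_continuousOn hjoint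
  have key := hasFDerivAt_integral_of_dominated_of_fderiv_le (𝕜 := ℝ) (μ := μ.restrict S)
    (F := fun q x => φ x * (1 - ℓ x q) ^ (-b))
    (F' := fun q x => (b * φ x * (1 - ℓ x q) ^ (-(b + 1))) • ℓ x) (bound := fun _ => C)
    (Metric.closedBall_mem_nhds p hε)
    (by
      filter_upwards [hU.mem_nhds hp] with q hq using
        (hφ.mul (hcont _ q hq)).aestronglyMeasurable hSm)
    (hint (hφ.mul (hcont _ p hp)))
    ((hF' p hp).aestronglyMeasurable hSm)
    (by
      filter_upwards [ae_restrict_mem hSm] with x hx q hq using hC (q, x) ⟨hq, hx⟩)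
    (integrable_const C)
    (by
      filter_upwards [ae_restrict_mem hSm] with x hx q hq
      have h1 : HasFDerivAt (fun q => 1 - ℓ x q) (-ℓ x) q := (ℓ x).hasFDerivAt.const_sub 1
      refine ((h1.rpow_const (p := -b) (Or.inl (hpos q (hball hq) x hx).ne')).const_mul
        (φ x)).congr_fderiv ?_
      ext u
      rw [show -(b + 1) = -b - 1 by ring]
      simp
      ring)
  refine key.congr_fderiv ?_
  have hb : ∀ j : Fin n, ∫ x in S, (b * φ x * (1 - ℓ x p) ^ (-(b + 1))) *
      ℓ x (EuclideanSpace.single j 1) ∂μ =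
      b * powIntegral μ S ℓ (fun x => φ x * ℓ x (EuclideanSpace.single j 1)) (b + 1) p := by
    intro j
    rw [powIntegral, ← integral_const_mul]
    congr 1
    ext x
    ring
  refine ContinuousLinearMap.coe_injective ((EuclideanSpace.basisFun (Fin n) ℝ).toBasis.ext ?_)
  intro j
  simp only [OrthonormalBasis.coe_toBasis, EuclideanSpace.basisFun_apply,
    ContinuousLinearMap.coe_coe]
  rw [ContinuousLinearMap.integral_apply (hint (hF' p hp))]
  simp only [smul_apply, smul_eq_mul, hb, sum_apply]
  simp [PiLp.single_apply]

theorem contDiffOn_powIntegral (hS : IsCompact S) (hμ : μ S ≠ ⊤)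
    (hℓ : ContinuousOn ℓ S)
    (hU : IsOpen U) (hpos : ∀ p ∈ U, ∀ x ∈ S, 0 < 1 - ℓ x p) {φ : X → ℝ}
    (hφ : ContinuousOn φ S) (b : ℝ) : ContDiffOn ℝ ∞ (powIntegral μ S ℓ φ b) U := by
  refine contDiffOn_infty.2 fun m => ?_
  induction m generalizing φ b with
  | zero =>
    exact contDiffOn_zero.2 fun p hp =>
      (hasFDerivAt_powIntegral hS hμ hℓ hU hpos hφ b hp).continuousAt.continuousWithinAt
  | succ m ih =>
    push_cast
    refine (contDiffOn_succ_iff_fderiv_of_isOpen hU).2 ⟨fun p hp =>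
      (hasFDerivAt_powIntegral hS hμ hℓ hU hpos hφ b hp).differentiableAt.differentiableWithinAt,
      by simp, ?_⟩
    refine ContDiffOn.congr (f := fun p => ∑ j, (b * powIntegral μ S ℓ
      (fun x => φ x * ℓ x (EuclideanSpace.single j 1)) (b + 1) p) •
        (EuclideanSpace.proj j : EuclideanSpace ℝ (Fin n) →L[ℝ] ℝ)) ?_ fun p hp =>
      (hasFDerivAt_powIntegral hS hμ hℓ hU hpos hφ b hp).fderiv
    refine ContDiffOn.sum fun j _ => ?_
    have hj : ContDiffOn ℝ m (powIntegral μ S ℓ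
        (fun x => φ x * ℓ x (EuclideanSpace.single j 1)) (b + 1)) U :=
      ih (hφ.mul (hℓ.clm_apply continuousOn_const)) (b + 1)
    exact (contDiffOn_const.mul hj).smul contDiffOn_const

theorem partialDeriv_powIntegral (hS : IsCompact S) (hμ : μ S ≠ ⊤)
    (hℓ : ContinuousOn ℓ S)
    (hU : IsOpen U) (hpos : ∀ p ∈ U, ∀ x ∈ S, 0 < 1 - ℓ x p) {φ : X → ℝ}
    (hφ : ContinuousOn φ S) (b : ℝ) {p : EuclideanSpace ℝ (Fin n)} (hp : p ∈ U) (j : Fin n) :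
    partialDeriv j (powIntegral μ S ℓ φ b) p =
      b * powIntegral μ S ℓ (fun x => φ x * ℓ x (EuclideanSpace.single j 1)) (b + 1) p := by
  have h := hasFDerivAt_powIntegral hS hμ hℓ hU hpos hφ b hp
  rw [partialDeriv_eq_fderiv h.differentiableAt, h.fderiv]
  simp [PiLp.single_apply]

theorem partialDeriv_eqOn {f g : EuclideanSpace ℝ (Fin n) → ℝ} (hU : IsOpen U)
    (h : Set.EqOn f g U) (j : Fin n) : Set.EqOn (partialDeriv j f) (partialDeriv j g) U :=
  fun _ hp => partialDeriv_congr (h.eventuallyEq_of_mem (hU.mem_nhds hp)) j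

theorem partialDeriv_const_mul {f : EuclideanSpace ℝ (Fin n) → ℝ}
    {p : EuclideanSpace ℝ (Fin n)} (hf : DifferentiableAt ℝ f p) (c : ℝ) (j : Fin n) :
    partialDeriv j (fun q => c * f q) p = c * partialDeriv j f p := by
  rw [partialDeriv_eq_fderiv hf, partialDeriv_eq_fderiv (hf.const_mul c),
    fderiv_const_mul hf]
  rfl

/-- The rising factor `b (b + 1) ⋯ (b + m - 1)`. -/
def risingFactor (b : ℝ) (m : ℕ) : ℝ := ∏ k ∈ Finset.range m, (b + k)

theorem iterate_partialDeriv_powIntegral (hS : IsCompact S) (hμ : μ S ≠ ⊤)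
    (hℓ : ContinuousOn ℓ S)
    (hU : IsOpen U) (hpos : ∀ p ∈ U, ∀ x ∈ S, 0 < 1 - ℓ x p) {φ : X → ℝ}
    (hφ : ContinuousOn φ S) (b : ℝ) (m : ℕ) {f : EuclideanSpace ℝ (Fin n) → ℝ}
    (hf : Set.EqOn f (fun p => risingFactor b m * powIntegral μ S ℓ φ (b + m) p) U)
    (j : Fin n) (k : ℕ) :
    Set.EqOn ((partialDeriv j)^[k] f) (fun p => risingFactor b (m + k) *
      powIntegral μ S ℓ (fun x => φ x * ℓ x (EuclideanSpace.single j 1) ^ k)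
        (b + (m + k : ℕ)) p) U := by
  induction k with
  | zero => simpa using hf
  | succ k ih =>
    rw [Function.iterate_succ_apply']
    refine (partialDeriv_eqOn hU ih j).trans fun p hp => ?_
    have hφ' : ContinuousOn (fun x => φ x * ℓ x (EuclideanSpace.single j 1) ^ k) S :=
      hφ.mul ((hℓ.clm_apply continuousOn_const).pow k)
    rw [partialDeriv_const_mul
      (hasFDerivAt_powIntegral hS hμ hℓ hU hpos hφ' _ hp).differentiableAt,
      partialDeriv_powIntegral hS hμ hℓ hU hpos hφ' _ hp, ← mul_assoc, ← add_assoc m k 1,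
      risingFactor, risingFactor, Finset.prod_range_succ]
    simp only [pow_succ, mul_assoc, Nat.cast_add, Nat.cast_one, add_assoc]

theorem foldr_partialDeriv_powIntegral (hS : IsCompact S) (hμ : μ S ≠ ⊤)
    (hℓ : ContinuousOn ℓ S)
    (hU : IsOpen U) (hpos : ∀ p ∈ U, ∀ x ∈ S, 0 < 1 - ℓ x p) {φ : X → ℝ}
    (hφ : ContinuousOn φ S) (b : ℝ) {f : EuclideanSpace ℝ (Fin n) → ℝ}
    (hf : Set.EqOn f (powIntegral μ S ℓ φ b) U) (i : Fin n → ℕ) (l : List (Fin n)) :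
    Set.EqOn (l.foldr (fun j h => (partialDeriv j)^[i j] h) f)
      (fun p => risingFactor b (l.map i).sum * powIntegral μ S ℓ
        (fun x => φ x * (l.map fun j => ℓ x (EuclideanSpace.single j 1) ^ i j).prod)
        (b + (l.map i).sum) p) U := by
  induction l with
  | nil => simpa [risingFactor] using hf
  | cons j l ih =>
    have hφ' : ContinuousOn
        (fun x => φ x * (l.map fun j => ℓ x (EuclideanSpace.single j 1) ^ i j).prod) S :=
      hφ.mul (continuousOn_list_prod l fun j _ => (hℓ.clm_apply continuousOn_const).pow _)
    have h := iterate_partialDeriv_powIntegral hS hμ hℓ hU hpos hφ' b _ ih j (i j)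
    simp only [List.foldr_cons, List.map_cons, List.sum_cons, List.prod_cons]
    rw [add_comm (i j)]
    simpa only [mul_assoc, mul_comm (List.prod _)] using h

theorem mixedPartial_powIntegral (hS : IsCompact S) (hμ : μ S ≠ ⊤)
    (hℓ : ContinuousOn ℓ S)
    (hU : IsOpen U) (hpos : ∀ p ∈ U, ∀ x ∈ S, 0 < 1 - ℓ x p) {φ : X → ℝ}
    (hφ : ContinuousOn φ S) (b : ℝ) {f : EuclideanSpace ℝ (Fin n) → ℝ}
    (hf : Set.EqOn f (powIntegral μ S ℓ φ b) U) (i : Fin n → ℕ)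
    {p : EuclideanSpace ℝ (Fin n)} (hp : p ∈ U) :
    mixedPartial i f p = risingFactor b (∑ j, i j) * powIntegral μ S ℓ
      (fun x => φ x * ∏ j, ℓ x (EuclideanSpace.single j 1) ^ i j) (b + (∑ j, i j : ℕ)) p := by
  have h := foldr_partialDeriv_powIntegral hS hμ hℓ hU hpos hφ b hf i (List.finRange n) hp
  have hsum : ((List.finRange n).map i).sum = ∑ j, i j := by
    rw [← List.ofFn_eq_map, List.sum_ofFn]
  have hprod : ∀ g : Fin n → ℝ, ((List.finRange n).map g).prod = ∏ j, g j := fun g => by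
    rw [← List.ofFn_eq_map, List.prod_ofFn]
  simp only [hsum, hprod] at h
  exact h

theorem risingFactor_eq_coeff (n m : ℕ) : risingFactor (((n : ℝ) - 1) / 2) m = coeff n m := by
  rw [risingFactor, coeff, ← Finset.card_range m, ← Finset.prod_const, Finset.card_range,
    ← Finset.prod_div_distrib]
  refine Finset.prod_congr rfl fun k _ => ?_
  ring

end Parametric

section Finite

variable {n : ℕ} {K : Set (EuclideanSpace ℝ (Fin n))} {p : EuclideanSpace ℝ (Fin n)}

theorem isCompact_indicatrix_zero (hK : Convex ℝ K) (hc : IsCompact K)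
    (h0 : (0 : EuclideanSpace ℝ (Fin n)) ∈ interior K) : IsCompact (indicatrix K 0) := by
  have hnhds := mem_interior_iff_mem_nhds.1 h0
  refine hc.of_isClosed_subset ?_ fun x hx => ?_
  · exact isClosed_eq (continuous_metric hK h0) continuous_const
  · rw [← hc.isClosed.closure_eq, ← gauge_le_one_iff_mem_closure hK hnhds]
    exact (mem_indicatrix_zero.1 hx).le

/-- The affine chart of the hyperplane `{x | x i = c}`. -/
def faceChart {m : ℕ} (i : Fin (m + 1)) (c : ℝ) (t : Fin m → ℝ) :
    EuclideanSpace ℝ (Fin (m + 1)) :=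
  WithLp.toLp 2 (i.insertNth c t : Fin (m + 1) → ℝ)

theorem contDiff_faceChart {m : ℕ} (i : Fin (m + 1)) (c : ℝ) : ContDiff ℝ 1 (faceChart i c) := by
  refine contDiff_euclidean.2 fun k => ?_
  rcases Fin.eq_self_or_eq_succAbove i k with rfl | ⟨j, rfl⟩
  · simpa [faceChart] using contDiff_const
  · simpa [faceChart] using contDiff_apply ℝ ℝ j

theorem faceChart_ne_zero {m : ℕ} (i : Fin (m + 1)) {c : ℝ} (hc : c ≠ 0) (t : Fin m → ℝ) :
    faceChart i c t ≠ 0 := by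
  intro h
  have := congrArg (fun x => x i) h
  simp [faceChart] at this
  exact hc this

theorem exists_faceChart_eq {m : ℕ} {x : EuclideanSpace ℝ (Fin (m + 1))} (hx : x ≠ 0) :
    ∃ i : Fin (m + 1), ∃ c ∈ ({1, -1} : Set ℝ), ∃ t ∈ Set.Icc (-1 : Fin m → ℝ) 1, ∃ r : ℝ,
      0 < r ∧ faceChart i c t = r • x := by
  obtain ⟨i, hi⟩ := Finite.exists_max fun i => |x i|
  have hxi : 0 < |x i| := by
    rw [abs_pos]
    intro h
    refine hx (PiLp.ext fun k => ?_)
    have := hi k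
    rw [h, abs_zero] at this
    simpa using this
  have hbound : ∀ k, |x k / (|x i|)| ≤ 1 := fun k => by
    rw [abs_div, abs_abs]
    exact div_le_one_of_le₀ (hi k) hxi.le
  refine ⟨i, x i / |x i|, ?_, fun j => x (i.succAbove j) / |x i|, ?_, |x i|⁻¹, inv_pos.2 hxi, ?_⟩
  · rcases abs_cases (x i) with ⟨h, -⟩ | ⟨h, -⟩
    · left; rw [h, div_self]; rintro h'; simp [h'] at hxi
    · right
      rw [h, div_neg, div_self, Set.mem_singleton_iff]
      rintro h'; simp [h'] at hxi
  · exact ⟨fun j => (abs_le.1 (hbound _)).1, fun j => (abs_le.1 (hbound _)).2⟩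
  · ext k
    rcases Fin.eq_self_or_eq_succAbove i k with rfl | ⟨j, rfl⟩
    · simp [faceChart, div_eq_inv_mul]
    · simp [faceChart, div_eq_inv_mul]

theorem hausdorffMeasure_indicatrix_zero_lt_top (hb : Bornology.IsBounded K)
    (h0 : (0 : EuclideanSpace ℝ (Fin n)) ∈ interior K) (hL : IsFinslerMinkowski (gauge K)) :
    (μHE[n - 1] : Measure (EuclideanSpace ℝ (Fin n))) (indicatrix K 0) < ⊤ := by
  rw [Measure.euclideanHausdorffMeasure_def, Measure.smul_apply, ENNReal.smul_def, smul_eq_mul]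
  refine ENNReal.mul_lt_top ENNReal.coe_lt_top ?_
  rcases n with _ | m
  · rw [show indicatrix K 0 = ∅ from Set.eq_empty_iff_forall_notMem.2 fun x hx =>
      ne_zero_of_mem_indicatrix hx (Subsingleton.elim _ _)]
    simp
  have hpos : ∀ {v : EuclideanSpace ℝ (Fin (m + 1))}, v ≠ 0 → 0 < gauge K v := fun hv => by
    rw [← metric_zero_left]; exact metric_pos hb h0 hv
  set f : Fin (m + 1) → ℝ → (Fin m → ℝ) → EuclideanSpace ℝ (Fin (m + 1)) := fun i c t =>
    (gauge K (faceChart i c t))⁻¹ • faceChart i c t with hf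
  have hcover : indicatrix K 0 ⊆
      ⋃ i : Fin (m + 1), ⋃ c ∈ ({1, -1} : Set ℝ), f i c '' Set.Icc (-1) 1 := by
    intro x hx
    obtain ⟨i, c, hc, t, ht, r, hr, h⟩ := exists_faceChart_eq (ne_zero_of_mem_indicatrix hx)
    refine Set.mem_iUnion.2 ⟨i, Set.mem_iUnion₂.2 ⟨c, hc, t, ht, ?_⟩⟩
    simp only [hf]
    rw [h, gauge_pos_smul hr, mem_indicatrix_zero.1 hx, mul_one, inv_smul_smul₀ hr.ne']
  refine (measure_mono hcover).trans_lt ?_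
  refine (measure_iUnion_fintype_le _ _).trans_lt (ENNReal.sum_lt_top.2 fun i _ => ?_)
  refine measure_biUnion_lt_top (by simp) fun c hc => ?_
  have hc0 : c ≠ 0 := by rcases hc with rfl | rfl <;> norm_num
  have hsmooth : ContDiff ℝ 1 (f i c) := by
    refine contDiff_iff_contDiffAt.2 fun t => ?_
    have hne := faceChart_ne_zero i hc0 t
    have h1 := (contDiff_faceChart i c).contDiffAt (x := t)
    have h2 : ContDiffAt ℝ 1 (fun t => gauge K (faceChart i c t)) t :=
      ContDiffAt.comp (g := gauge K) t ((hL _ hne).1.of_le (by norm_num)) h1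
    exact (h2.inv (hpos hne).ne').smul h1
  obtain ⟨C, hC⟩ := hsmooth.contDiffOn.exists_lipschitzOnWith (s := Set.Icc (-1) 1) (by norm_num)
    (convex_Icc _ _) isCompact_Icc
  refine (hC.hausdorffMeasure_image_le (by positivity)).trans_lt ?_
  refine ENNReal.mul_lt_top (ENNReal.rpow_lt_top_of_nonneg (by positivity) ENNReal.coe_ne_top) ?_
  have h1 := hausdorffMeasure_pi_real (ι := Fin m)
  rw [Fintype.card_fin] at h1
  rw [Nat.add_sub_cancel, h1]
  exact isCompact_Icc.measure_lt_top

end Finite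

section Pullback

variable {n : ℕ} {K : Set (EuclideanSpace ℝ (Fin n))} {p : EuclideanSpace ℝ (Fin n)}

theorem measurableSet_indicatrix (hK : Convex ℝ K) (hp : p ∈ interior K) :
    MeasurableSet (indicatrix K p) :=
  (isClosed_eq (continuous_metric hK hp) continuous_const).measurableSet

theorem continuousOn_rpow_one_sub (hK : Convex ℝ K) (hp : p ∈ interior K)
    (h0 : (0 : EuclideanSpace ℝ (Fin n)) ∈ interior K) (hL : IsFinslerMinkowski (gauge K))
    (c : ℝ) : ContinuousOn (fun x => (1 - fderiv ℝ (gauge K) x p) ^ c) (indicatrix K 0) :=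
  (continuousOn_const.sub ((continuousOn_fderiv_gauge hL).clm_apply
    continuousOn_const)).rpow_const fun _ hx =>
      Or.inl (one_sub_fderiv_gauge_pos hK hp h0 hL (ne_zero_of_mem_indicatrix hx)).ne'

theorem aemeasurable_density (hK : Convex ℝ K) (hb : Bornology.IsBounded K)
    (hp : p ∈ interior K) (h0 : (0 : EuclideanSpace ℝ (Fin n)) ∈ interior K)
    (hL : IsFinslerMinkowski (gauge K)) (μ : Measure (EuclideanSpace ℝ (Fin n))) :
    AEMeasurable (fun y => ENNReal.ofReal (density K p y)) (μ.restrict (indicatrix K p)) := by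
  have h : ContinuousOn (density K p) (indicatrix K p) :=
    (((continuousOn_rpow_one_sub hK hp h0 hL _).mul (continuousOn_density_zero hL)).comp
      (continuous_const_add p).continuousOn
      fun _ hy => add_mem_indicatrix_zero hK hp h0 hy).congr
      fun _ hy => density_eq hK hb hp h0 hL hy
  exact (h.aemeasurable (measurableSet_indicatrix hK hp)).ennreal_ofReal

theorem toReal_density_smul (hK : Convex ℝ K) (hb : Bornology.IsBounded K)
    (hp : p ∈ interior K) (h0 : (0 : EuclideanSpace ℝ (Fin n)) ∈ interior K)
    (hL : IsFinslerMinkowski (gauge K)) (g : EuclideanSpace ℝ (Fin n) → ℝ)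
    {y : EuclideanSpace ℝ (Fin n)} (hy : y ∈ indicatrix K p) :
    (ENNReal.ofReal (density K p y)).toReal • g y =
      (fun x => density K 0 x * (1 - fderiv ℝ (gauge K) x p) ^ (-(((n : ℝ) - 1) / 2)) *
        g (x - p)) (p + y) := by
  have hx := add_mem_indicatrix_zero hK hp h0 hy
  have hs := one_sub_fderiv_gauge_pos hK hp h0 hL (ne_zero_of_mem_indicatrix hx)
  rw [density_eq hK hb hp h0 hL hy, ENNReal.toReal_ofReal
    (mul_nonneg (Real.rpow_nonneg hs.le _) (density_zero_nonneg hL hx))]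
  simp only [add_sub_cancel_left, smul_eq_mul]
  ring

/-- Integrals over `∂K_p` pulled back to the fixed hypersurface `∂K`. -/
theorem integral_indicatrixMeasure (hK : Convex ℝ K) (hb : Bornology.IsBounded K)
    (hp : p ∈ interior K) (h0 : (0 : EuclideanSpace ℝ (Fin n)) ∈ interior K)
    (hL : IsFinslerMinkowski (gauge K)) (g : EuclideanSpace ℝ (Fin n) → ℝ) :
    ∫ y, g y ∂(indicatrixMeasure K p) =
      ∫ x in indicatrix K 0, density K 0 x *
        (1 - fderiv ℝ (gauge K) x p) ^ (-(((n : ℝ) - 1) / 2)) * g (x - p) ∂μHE[n - 1] := by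
  have h1 : ∫ y, g y ∂(indicatrixMeasure K p) = ∫ y in indicatrix K p,
      (ENNReal.ofReal (density K p y)).toReal • g y ∂μHE[n - 1] :=
    integral_withDensity_eq_integral_toReal_smul₀ (aemeasurable_density hK hb hp h0 hL μHE[n - 1])
    (Eventually.of_forall fun _ => ENNReal.ofReal_lt_top) g
  rw [h1, setIntegral_congr_fun (measurableSet_indicatrix hK hp)
    fun y hy => toReal_density_smul hK hb hp h0 hL g hy, indicatrix_eq_preimage hK hp h0]
  exact (measurePreserving_add_left μHE[n - 1] p).setIntegral_preimage_emb
    (measurableEmbedding_addLeft p) (fun x => density K 0 x *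
      (1 - fderiv ℝ (gauge K) x p) ^ (-(((n : ℝ) - 1) / 2)) * g (x - p)) _

theorem integrable_indicatrixMeasure (hK : Convex ℝ K) (hc : IsCompact K)
    (hp : p ∈ interior K) (h0 : (0 : EuclideanSpace ℝ (Fin n)) ∈ interior K)
    (hL : IsFinslerMinkowski (gauge K)) {g : EuclideanSpace ℝ (Fin n) → ℝ}
    (hg : ContinuousOn (fun x => g (x - p)) (indicatrix K 0)) :
    Integrable g (indicatrixMeasure K p) := by
  have hb := hc.isBounded
  have hcont : ContinuousOn (fun x => density K 0 x *
      (1 - fderiv ℝ (gauge K) x p) ^ (-(((n : ℝ) - 1) / 2)) * g (x - p)) (indicatrix K 0) :=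
    ((continuousOn_density_zero hL).mul (continuousOn_rpow_one_sub hK hp h0 hL _)).mul hg
  have hS := isCompact_indicatrix_zero hK hc h0
  obtain ⟨C, hC⟩ := hS.exists_bound_of_continuousOn hcont
  have h1 : IntegrableOn (fun x => density K 0 x *
      (1 - fderiv ℝ (gauge K) x p) ^ (-(((n : ℝ) - 1) / 2)) * g (x - p)) (indicatrix K 0)
      μHE[n - 1] := by
    refine IntegrableOn.of_bound (hausdorffMeasure_indicatrix_zero_lt_top hb h0 hL)
      (hcont.aestronglyMeasurable hS.measurableSet) C ?_
    filter_upwards [ae_restrict_mem hS.measurableSet] with x hx using hC x hx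
  have h2 := ((measurePreserving_add_left μHE[n - 1] p).integrableOn_comp_preimage
    (measurableEmbedding_addLeft p)).2 h1
  rw [← indicatrix_eq_preimage hK hp h0] at h2
  exact (integrable_withDensity_iff_integrable_smul₀' (aemeasurable_density hK hb hp h0 hL _)
    (Eventually.of_forall fun _ => ENNReal.ofReal_lt_top)).2
      (h2.congr_fun (fun y hy => (toReal_density_smul hK hb hp h0 hL g hy).symm)
        (measurableSet_indicatrix hK hp))

theorem prod_partialDeriv_metric (hK : Convex ℝ K) (hb : Bornology.IsBounded K)
    (hp : p ∈ interior K) (h0 : (0 : EuclideanSpace ℝ (Fin n)) ∈ interior K)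
    (hL : IsFinslerMinkowski (gauge K)) (i : Fin n → ℕ) {x : EuclideanSpace ℝ (Fin n)}
    (hx : x ∈ indicatrix K 0) :
    ∏ j, partialDeriv j (metric K p) (x - p) ^ i j =
      (1 - fderiv ℝ (gauge K) x p) ^ (-((∑ j, i j : ℕ) : ℝ)) *
        ∏ j, fderiv ℝ (gauge K) x (EuclideanSpace.single j 1) ^ i j := by
  have hy : x - p ∈ indicatrix K p := by
    rw [indicatrix_eq_preimage hK hp h0]
    simpa using hx
  have h1 := hasFDerivAt_metric_of_mem_indicatrix hK hb hp h0 hL hy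
  rw [add_sub_cancel] at h1
  have hs := one_sub_fderiv_gauge_pos hK hp h0 hL (ne_zero_of_mem_indicatrix hx)
  simp only [partialDeriv_eq_fderiv h1.differentiableAt, h1.fderiv, smul_apply, smul_eq_mul,
    mul_pow]
  rw [Finset.prod_mul_distrib, Finset.prod_pow_eq_pow_sum, inv_pow, Real.rpow_neg hs.le,
    Real.rpow_natCast]

end Pullback

end Funk

end

theorem theorem2 (n : ℕ) (K : ConvexBody (EuclideanSpace ℝ (Fin n)))
    (h0 : (0 : EuclideanSpace ℝ (Fin n)) ∈ interior (K : Set (EuclideanSpace ℝ (Fin n))))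
    (hL : Funk.IsFinslerMinkowski (gauge (K : Set (EuclideanSpace ℝ (Fin n))))) :
    ContDiffOn ℝ ∞ (Funk.area (K : Set (EuclideanSpace ℝ (Fin n))))
        (interior (K : Set (EuclideanSpace ℝ (Fin n)))) ∧
      ∀ p ∈ interior (K : Set (EuclideanSpace ℝ (Fin n))), ∀ i : Fin n → ℕ,
        Integrable
            (fun y => ∏ j, Funk.partialDeriv j (Funk.metric (K : Set _) p) y ^ i j)
            (Funk.indicatrixMeasure (K : Set (EuclideanSpace ℝ (Fin n))) p) ∧
          Funk.mixedPartial i (Funk.area (K : Set (EuclideanSpace ℝ (Fin n)))) p =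
            Funk.coeff n (∑ j, i j) *
              ∫ y, ∏ j, Funk.partialDeriv j (Funk.metric (K : Set _) p) y ^ i j
                ∂(Funk.indicatrixMeasure (K : Set (EuclideanSpace ℝ (Fin n))) p) := by
  have hK := K.convex
  have hc := K.isCompact
  have hb := hc.isBounded
  have hS := Funk.isCompact_indicatrix_zero hK hc h0
  have hμ := (Funk.hausdorffMeasure_indicatrix_zero_lt_top hb h0 hL).ne
  have hℓ := Funk.continuousOn_fderiv_gauge hL
  have hφ := Funk.continuousOn_density_zero hL
  have hpos : ∀ p ∈ interior (K : Set (EuclideanSpace ℝ (Fin n))),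
      ∀ x ∈ Funk.indicatrix (K : Set (EuclideanSpace ℝ (Fin n))) 0,
        0 < 1 - fderiv ℝ (gauge (K : Set (EuclideanSpace ℝ (Fin n)))) x p := fun p hp x hx =>
    Funk.one_sub_fderiv_gauge_pos hK hp h0 hL (Funk.ne_zero_of_mem_indicatrix hx)
  have harea : Set.EqOn (Funk.area (K : Set (EuclideanSpace ℝ (Fin n))))
      (Funk.powIntegral μHE[n - 1] (Funk.indicatrix K 0) (fderiv ℝ (gauge K)) (Funk.density K 0)
        (((n : ℝ) - 1) / 2)) (interior K) := fun p hp => by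
    rw [Funk.area, Funk.integral_indicatrixMeasure hK hb hp h0 hL]
    simp only [mul_one, Funk.powIntegral]
  refine ⟨(Funk.contDiffOn_powIntegral hS hμ hℓ isOpen_interior hpos hφ _).congr harea,
    fun p hp i => ⟨?_, ?_⟩⟩
  · refine Funk.integrable_indicatrixMeasure hK hc hp h0 hL (ContinuousOn.congr ?_
      fun x hx => Funk.prod_partialDeriv_metric hK hb hp h0 hL i hx)
    exact (Funk.continuousOn_rpow_one_sub hK hp h0 hL _).mul (continuousOn_finsetProd _
      fun j _ => (hℓ.clm_apply continuousOn_const).pow _)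
  · rw [Funk.mixedPartial_powIntegral hS hμ hℓ isOpen_interior hpos hφ _ harea i hp,
      Funk.risingFactor_eq_coeff, Funk.integral_indicatrixMeasure hK hb hp h0 hL,
      Funk.powIntegral]
    congr 1
    refine setIntegral_congr_fun hS.measurableSet fun x hx => ?_
    rw [Funk.prod_partialDeriv_metric hK hb hp h0 hL i hx, neg_add,
      Real.rpow_add (hpos p hp x hx)]
    ring
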